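/- Let $r \ge 2$ and $N \ge 1$ be integers, and suppose that there is an $r$-coloring of $\mathbb{Z}/N\mathbb{Z}$ (a map $c : \mathbb{Z}/N\mathbb{Z} \to \{1,\dots,r\}$) with no symmetrically colored 4-term arithmetic progression, that is, there are no $n, d \in \mathbb{Z}/N\mathbb{Z}$ with $d \neq 0$, $c(n) = c(n+3d)$ and $c(n+d) = c(n+2d)$. Then there is a constant $C$ depending only on $r$ and $N$ such that for all $0 < \alpha < 1/2$, \[ \rho_4(\alpha) \le C\, \alpha^{3 + \frac12 \log_r N}. \] Here, for $M \ge 1$ and $A \subseteq \mathbb{Z}/M\mathbb{Z}$, write \[ \widehat{1_A}(s) = \frac1M \sum_{n \in \mathbb{Z}/M\mathbb{Z}} 1_A(n) e^{-2\pi i s n/M}, \qquad \Lambda_4(1_A) = \frac{1}{M^2} \sum_{n, d \in \mathbb{Z}/M\mathbb{Z}} 1_A(n) 1_A(n+d) 1_A(n+2d) 1_A(n+3d). \] The set $A$ is called $\eta$-Fourier uniform if $|\widehat{1_A}(s)| \le \eta$ for all $s \neq 0$. For $0 < \alpha < 1$, $\rho_4(\alpha)$ is the supremum of all real $\rho$ such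 that for every $\epsilon > 0$ there exist $\eta > 0$ and $M_0$ such that every $\eta$-Fourier uniform $A \subseteq \mathbb{Z}/M\mathbb{Z}$ with $M \ge M_0$ and $|A| \ge (\alpha - \epsilon) M$ satisfies $\Lambda_4(1_A) \ge \rho - \epsilon$. -/

import Mathlib

open Finset

/-- A coloring `c` of `ℤ/Nℤ` has no symmetrically colored 4-AP: there are no `n` and `d ≠ 0` such
that `n`, `n + 3d` share a color and `n + d`, `n + 2d` share a color. -/
def AvoidsSymmetricFourAP {N r : ℕ} (c : ZMod N → Fin r) : Prop :=
  ∀ n d : ZMod N, d ≠ 0 → ¬ (c n = c (n + 3 * d) ∧ c (n + d) = c (n + 2 * d))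

/-- The indicator function of `A ⊆ ℤ/Nℤ`, with values in `𝕜` (`ℝ` or `ℂ` below). -/
noncomputable def indicatorFn (𝕜 : Type*) [Zero 𝕜] [One 𝕜] {N : ℕ} (A : Finset (ZMod N)) :
    ZMod N → 𝕜 :=
  Set.indicator (A : Set (ZMod N)) (fun _ => 1)

/-- The Fourier transform `f̂(r) = 𝔼_n f(n) exp(-2πi r n / N)` on `ℤ/Nℤ`
(`ZMod.stdAddChar j = exp(2πi j / N)`). -/
noncomputable def fourierZMod {N : ℕ} [NeZero N] (f : ZMod N → ℂ) (r : ZMod N) : ℂ :=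
  (∑ n : ZMod N, f n * ZMod.stdAddChar (-(r * n))) / (N : ℂ)

/-- `A ⊆ ℤ/Nℤ` is `η`-Fourier uniform. -/
def IsFourierUniform {N : ℕ} [NeZero N] (η : ℝ) (A : Finset (ZMod N)) : Prop :=
  ∀ r : ZMod N, r ≠ 0 → ‖fourierZMod (indicatorFn ℂ A) r‖ ≤ η

/-- `Λ₄(f) = 𝔼_{n,d} f(n) f(n+d) f(n+2d) f(n+3d)`. -/
noncomputable def Lambda4 {N : ℕ} [NeZero N] (f : ZMod N → ℝ) : ℝ :=
  (∑ n : ZMod N, ∑ d : ZMod N, f n * f (n + d) * f (n + 2 * d) * f (n + 3 * d)) / (N : ℝ) ^ 2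

/-- `ρ` is an asymptotic lower bound for the 4-AP density of Fourier uniform sets of density `α`:
for every `ε > 0` there are `η > 0` and `N₀` such that every `η`-Fourier uniform `A ⊆ ℤ/Nℤ` with
`N ≥ N₀` and `|A| ≥ (α - ε) N` has `Λ₄(1_A) ≥ ρ - ε`. -/
def IsFourAPLowerBound (α ρ : ℝ) : Prop :=
  ∀ ε : ℝ, 0 < ε → ∃ η : ℝ, 0 < η ∧ ∃ N₀ : ℕ, ∀ (N : ℕ) [NeZero N], N₀ ≤ N →
    ∀ A : Finset (ZMod N), IsFourierUniform η A → (α - ε) * (N : ℝ) ≤ (#A : ℝ) →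
      ρ - ε ≤ Lambda4 (indicatorFn ℝ A)

/-- `ρ₄(α)`: the largest (supremal) `ρ` with the above property. For `α ≤ 1` the set is nonempty
and bounded above, as shown below. -/
noncomputable def rho4 (α : ℝ) : ℝ :=
  sSup {ρ : ℝ | IsFourAPLowerBound α ρ}

theorem isFourAPLowerBound_zero (α : ℝ) : IsFourAPLowerBound α 0 := by
  intro ε hε
  refine ⟨1, one_pos, 0, fun N _ _ A _ _ => ?_⟩
  have h : ∀ x : ZMod N, 0 ≤ indicatorFn ℝ A x := fun x =>
    Set.indicator_nonneg (fun _ _ => zero_le_one) x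
  have : 0 ≤ Lambda4 (indicatorFn ℝ A) := by
    unfold Lambda4
    refine div_nonneg (sum_nonneg fun n _ => sum_nonneg fun d _ => ?_) (by positivity)
    exact mul_nonneg (mul_nonneg (mul_nonneg (h _) (h _)) (h _)) (h _)
  linarith

theorem isFourAPLowerBound_le_one {α ρ : ℝ} (hα : α ≤ 1) (h : IsFourAPLowerBound α ρ) :
    ρ ≤ 1 := by
  refine le_of_forall_pos_le_add fun ε hε => ?_
  obtain ⟨η, hη, N₀, H⟩ := h ε hε
  have hN : ((N₀ + 1 : ℕ) : ℝ) ≠ 0 := by positivity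
  have hu : IsFourierUniform η (univ : Finset (ZMod (N₀ + 1))) := by
    intro r hr
    have h1 : ∑ n : ZMod (N₀ + 1), (ZMod.stdAddChar (-(r * n)) : ℂ) = 0 := by
      have h2 := AddChar.sum_mulShift (-r) (ZMod.isPrimitive_stdAddChar (N₀ + 1))
      rw [if_neg (neg_ne_zero.mpr hr)] at h2
      rw [Nat.cast_zero] at h2
      refine Eq.trans (sum_congr rfl fun n _ => ?_) h2
      rw [mul_neg, mul_comm]
    have h3 : fourierZMod (indicatorFn ℂ (univ : Finset (ZMod (N₀ + 1)))) r = 0 := by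
      simp [fourierZMod, indicatorFn, h1]
    rw [h3, norm_zero]
    exact hη.le
  have h4 := H (N₀ + 1) (Nat.le_succ _) univ hu (by
    rw [card_univ, ZMod.card]
    have : (0 : ℝ) ≤ ((N₀ + 1 : ℕ) : ℝ) := by positivity
    nlinarith)
  have h5 : Lambda4 (indicatorFn ℝ (univ : Finset (ZMod (N₀ + 1)))) = 1 := by
    simp only [Lambda4, indicatorFn, coe_univ, Set.indicator_univ, mul_one, sum_const, card_univ,
      ZMod.card, nsmul_eq_mul]
    rw [div_eq_one_iff_eq (pow_ne_zero _ hN), sq]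
  linarith

theorem rho4_set_nonempty_bddAbove {α : ℝ} (hα : α ≤ 1) :
    {ρ : ℝ | IsFourAPLowerBound α ρ}.Nonempty ∧ BddAbove {ρ : ℝ | IsFourAPLowerBound α ρ} :=
  ⟨⟨0, isFourAPLowerBound_zero α⟩, ⟨1, fun _ h => isFourAPLowerBound_le_one hα h⟩⟩

/-- Reading base `3` digits in base `9` gives a map of quadratic growth whose values satisfy
`x + 3y = z + 3w` only trivially. -/
theorem exists_quadratic_growth_unique_add_three_mul :
    ∃ f : ℕ → ℕ, (∀ m, f m ≤ m ^ 2) ∧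
      ∀ a b c d, f a + 3 * f b = f c + 3 * f d → a = c ∧ b = d := by
  have hrec : ∀ m, Nat.ofDigits 9 (Nat.digits 3 m)
      = m % 3 + 9 * Nat.ofDigits 9 (Nat.digits 3 (m / 3)) := by
    intro m
    rcases Nat.eq_zero_or_pos m with rfl | hm
    · simp
    · rw [Nat.digits_def' (by norm_num) hm, Nat.ofDigits_cons]
  refine ⟨fun m => Nat.ofDigits 9 (Nat.digits 3 m), fun m => ?_, fun a => ?_⟩
  · induction m using Nat.strong_induction_on with
    | _ m ih =>
      rcases Nat.eq_zero_or_pos m with rfl | hm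
      · simp
      · have h1 := ih (m / 3) (by omega)
        have h2 := hrec m
        have h3 : m % 3 < 3 := Nat.mod_lt _ (by norm_num)
        have h4 := Nat.div_add_mod m 3
        simp only at h1 ⊢
        rw [h2]
        generalize m % 3 = x at *
        generalize m / 3 = y at *
        subst h4
        nlinarith [Nat.zero_le (x * y), Nat.le_self_pow (two_ne_zero) x]
  · have key : ∀ n a b c d : ℕ, a + b + c + d ≤ n →
        Nat.ofDigits 9 (Nat.digits 3 a) + 3 * Nat.ofDigits 9 (Nat.digits 3 b)
          = Nat.ofDigits 9 (Nat.digits 3 c) + 3 * Nat.ofDigits 9 (Nat.digits 3 d) →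
        a = c ∧ b = d := by
      intro n
      induction n with
      | zero => intros; omega
      | succ n ih =>
        intro a b c d hn h
        by_cases h0 : a + b + c + d = 0
        · omega
        have h1 := ih (a / 3) (b / 3) (c / 3) (d / 3) (by omega)
        rw [hrec a, hrec b, hrec c, hrec d] at h
        generalize Nat.ofDigits 9 (Nat.digits 3 (a / 3)) = A at *
        generalize Nat.ofDigits 9 (Nat.digits 3 (b / 3)) = B at *
        generalize Nat.ofDigits 9 (Nat.digits 3 (c / 3)) = C at *
        generalize Nat.ofDigits 9 (Nat.digits 3 (d / 3)) = D at *
        have h2 := h1 (by omega)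
        omega
    exact fun b c d => key _ a b c d le_rfl

theorem ZMod.val_add_div_of_dvd {N N' : ℕ} [NeZero N] [NeZero N'] (x d : ZMod (N * N'))
    (hd : N ∣ d.val) :
    (((x + d).val / N : ℕ) : ZMod N') = ((x.val / N : ℕ) : ZMod N') + ((d.val / N : ℕ) : ZMod N') := by
  rw [ZMod.val_add, Nat.mod_mul_right_div_self, Nat.add_div_of_dvd_left hd, ZMod.natCast_mod,
    Nat.cast_add]

/-- Colorings without symmetrically colored 4-APs can be multiplied. -/
theorem AvoidsSymmetricFourAP.mul {N N' r r' : ℕ} [NeZero N] [NeZero N'] {c : ZMod N → Fin r}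
    {c' : ZMod N' → Fin r'} (hc : AvoidsSymmetricFourAP c) (hc' : AvoidsSymmetricFourAP c') :
    ∃ c'' : ZMod (N * N') → Fin (r * r'), AvoidsSymmetricFourAP c'' := by
  refine ⟨fun x => finProdFinEquiv
    (c (ZMod.castHom (dvd_mul_right N N') (ZMod N) x), c' ((x.val / N : ℕ) : ZMod N')), ?_⟩
  intro n d hd h
  simp only [EmbeddingLike.apply_eq_iff_eq, Prod.mk.injEq, map_add, map_mul, map_ofNat] at h
  obtain ⟨⟨h1, h2⟩, h3, h4⟩ := h
  by_cases h0 : ZMod.castHom (dvd_mul_right N N') (ZMod N) d = 0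
  · have hdv : N ∣ d.val := by
      rw [← ZMod.natCast_eq_zero_iff, ← h0, ZMod.castHom_apply, ZMod.cast_eq_val]
    refine hc' ((n.val / N : ℕ) : ZMod N') ((d.val / N : ℕ) : ZMod N') (fun h => ?_) ⟨?_, ?_⟩
    · rw [ZMod.natCast_eq_zero_iff] at h
      have := Nat.mul_dvd_mul_left N h
      rw [Nat.mul_div_cancel' hdv] at this
      exact hd ((ZMod.val_eq_zero d).1 (Nat.eq_zero_of_dvd_of_lt this (ZMod.val_lt d)))
    · rw [h2, show n + 3 * d = n + d + d + d by ring]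
      simp only [ZMod.val_add_div_of_dvd _ d hdv]
      congr 1
      ring
    · rw [show n + 2 * d = n + d + d by ring] at h4
      simp only [ZMod.val_add_div_of_dvd _ d hdv] at h4
      rw [h4]
      congr 1
      ring
  · exact hc _ _ h0 ⟨h1, h3⟩

theorem AvoidsSymmetricFourAP.pow {N r : ℕ} [NeZero N] {c : ZMod N → Fin r}
    (hc : AvoidsSymmetricFourAP c) (k : ℕ) :
    ∃ c' : ZMod (N ^ k) → Fin (r ^ k), AvoidsSymmetricFourAP c' := by
  induction k with
  | zero =>
    refine ⟨fun _ => 0, fun n d hd => (hd ?_).elim⟩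
    exact @Subsingleton.elim (ZMod 1) _ _ _
  | succ k ih =>
    obtain ⟨c', hc'⟩ := ih
    exact hc'.mul hc

/-- The residues mod `p` represented in `[a, a + h)`. -/
def residueInterval (p a h : ℕ) [NeZero p] : Finset (ZMod p) :=
  univ.filter fun x => a ≤ x.val ∧ x.val < a + h

theorem mem_residueInterval {p a h : ℕ} [NeZero p] {x : ZMod p} :
    x ∈ residueInterval p a h ↔ a ≤ x.val ∧ x.val < a + h := by
  simp [residueInterval]

theorem eq_of_mem_residueInterval {p h K : ℕ} [NeZero p] (hp : 16 * K ^ 2 * h ≤ p)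
    {f : ℕ → ℕ} (hf : ∀ m, f m ≤ m ^ 2)
    (hf' : ∀ a b c d, f a + 3 * f b = f c + 3 * f d → a = c ∧ b = d)
    {v₀ v₁ v₂ v₃ : ℕ} (h₀ : v₀ < K) (h₁ : v₁ < K) (h₂ : v₂ < K) (h₃ : v₃ < K)
    {x₀ x₁ x₂ x₃ : ZMod p} (m₀ : x₀ ∈ residueInterval p (4 * f v₀ * h) h)
    (m₁ : x₁ ∈ residueInterval p (4 * f v₁ * h) h)
    (m₂ : x₂ ∈ residueInterval p (4 * f v₂ * h) h)
    (m₃ : x₃ ∈ residueInterval p (4 * f v₃ * h) h) (hx : x₀ - 3 * x₁ + 3 * x₂ - x₃ = 0) :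
    v₀ = v₃ ∧ v₁ = v₂ := by
  rw [mem_residueInterval] at m₀ m₁ m₂ m₃
  have hb : ∀ v < K, f v + 1 ≤ K ^ 2 := fun v hv => by nlinarith [hf v]
  have b₀ := hb _ h₀
  have b₁ := hb _ h₁
  have b₂ := hb _ h₂
  have b₃ := hb _ h₃
  have hdvd : (p : ℤ) ∣ (x₀.val : ℤ) - 3 * x₁.val + 3 * x₂.val - x₃.val := by
    rw [← ZMod.intCast_zmod_eq_zero_iff_dvd]
    push_cast
    simpa using hx
  have hpos : (0 : ℤ) < h := by omega
  generalize x₀.val = y₀ at *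
  generalize x₁.val = y₁ at *
  generalize x₂.val = y₂ at *
  generalize x₃.val = y₃ at *
  have hp' : 16 * (K : ℤ) ^ 2 * h ≤ p := by exact_mod_cast hp
  zify at m₀ m₁ m₂ m₃ b₀ b₁ b₂ b₃
  have c₀ := mul_le_mul_of_nonneg_right b₀ hpos.le
  have c₁ := mul_le_mul_of_nonneg_right b₁ hpos.le
  have c₂ := mul_le_mul_of_nonneg_right b₂ hpos.le
  have c₃ := mul_le_mul_of_nonneg_right b₃ hpos.le
  have e : ∀ v, 0 ≤ (f v : ℤ) * h := fun v => by positivity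
  have hz : (y₀ : ℤ) - 3 * y₁ + 3 * y₂ - y₃ = 0 := by
    refine Int.eq_zero_of_abs_lt_dvd hdvd ?_
    rw [abs_lt]
    constructor <;> nlinarith [e v₀, e v₁, e v₂, e v₃]
  have k1 : ((f v₀ : ℤ) - 3 * f v₁ + 3 * f v₂ - f v₃) < 1 := by
    by_contra! hcon
    nlinarith [mul_le_mul_of_nonneg_right hcon hpos.le]
  have k2 : -1 < ((f v₀ : ℤ) - 3 * f v₁ + 3 * f v₂ - f v₃) := by
    by_contra! hcon
    nlinarith [mul_le_mul_of_nonneg_right hcon hpos.le]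
  have := hf' v₀ v₂ v₃ v₁ (by omega)
  exact ⟨this.1, this.2.symm⟩

section FourierAnalysis

theorem sum_fourierZMod_mul_stdAddChar {N : ℕ} [NeZero N] (f : ZMod N → ℂ) (x : ZMod N) :
    ∑ u, fourierZMod f u * ZMod.stdAddChar (u * x) = f x := by
  have h1 : ∀ u, fourierZMod f u = (N : ℂ)⁻¹ * ZMod.dft f u := by
    intro u
    rw [fourierZMod, ZMod.dft_apply, div_eq_inv_mul]
    congr 1
    refine sum_congr rfl fun n _ => ?_
    rw [smul_eq_mul, mul_comm, mul_comm u]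
  have h2 := congrFun (ZMod.dft.symm_apply_apply f) x
  rw [ZMod.invDFT_apply] at h2
  rw [← h2, smul_eq_mul, mul_sum]
  refine sum_congr rfl fun u _ => ?_
  rw [h1, smul_eq_mul]
  ring

variable {p : ℕ} [Fact p.Prime]

theorem norm_sum_stdAddChar_mul_sq_le (hp : p ≠ 2) {u : ZMod p} (hu : u ≠ 0)
    (ψ : AddChar (ZMod p) ℂ) :
    ‖∑ b : ZMod p, ZMod.stdAddChar (u * b ^ 2) * ψ b‖ ≤ √p := by
  have h2 : (2 : ZMod p) ≠ 0 := by
    exact_mod_cast ZMod.prime_ne_zero p 2 hp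
  have key : (∑ b : ZMod p, ZMod.stdAddChar (u * b ^ 2) * ψ b) *
      (starRingEnd ℂ) (∑ b : ZMod p, ZMod.stdAddChar (u * b ^ 2) * ψ b) = p := by
    rw [map_sum, sum_mul_sum, sum_comm]
    have h3 : ∀ c : ZMod p, ∑ b : ZMod p, ZMod.stdAddChar (u * b ^ 2) * ψ b *
        (starRingEnd ℂ) (ZMod.stdAddChar (u * c ^ 2) * ψ c)
        = ∑ h : ZMod p, ZMod.stdAddChar (u * h ^ 2) * ψ h *
          (ZMod.stdAddChar (c * (2 * u * h)) : ℂ) := by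
      intro c
      rw [← Equiv.sum_comp (Equiv.addRight c)]
      refine sum_congr rfl fun h _ => ?_
      simp only [Equiv.coe_addRight]
      rw [map_mul (starRingEnd ℂ), ← AddChar.map_neg_eq_conj, ← AddChar.map_neg_eq_conj,
        AddChar.map_add_eq_mul ψ]
      have e1 : (ψ c : ℂ) * ψ (-c) = 1 := by
        rw [← AddChar.map_add_eq_mul, add_neg_cancel, AddChar.map_zero_eq_one]
      have e2 : (ZMod.stdAddChar (u * (h + c) ^ 2) : ℂ) * ZMod.stdAddChar (-(u * c ^ 2))
          = ZMod.stdAddChar (u * h ^ 2) * ZMod.stdAddChar (c * (2 * u * h)) := by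
        rw [← AddChar.map_add_eq_mul, ← AddChar.map_add_eq_mul]
        congr 1
        ring
      linear_combination (ZMod.stdAddChar (u * (h + c) ^ 2) : ℂ) *
        ZMod.stdAddChar (-(u * c ^ 2)) * ψ h * e1 + ψ h * e2
    simp_rw [h3]
    rw [sum_comm]
    simp_rw [← mul_sum, AddChar.sum_mulShift _ (ZMod.isPrimitive_stdAddChar p)]
    rw [Finset.sum_eq_single 0]
    · simp [ZMod.card]
    · intro h _ hh
      simp [h2, hu, hh]
    · simp
  rw [Complex.mul_conj, Complex.normSq_eq_norm_sq] at key
  have key' : ‖∑ b : ZMod p, ZMod.stdAddChar (u * b ^ 2) * ψ b‖ ^ 2 = p := by exact_mod_cast key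
  exact Real.le_sqrt_of_sq_le key'.le

theorem norm_sum_comp_sq_mul_addChar_sub_le (hp : p ≠ 2) (f : ZMod p → ℂ)
    (ψ : AddChar (ZMod p) ℂ) :
    ‖∑ b, f (b ^ 2) * ψ b - fourierZMod f 0 * ∑ b, ψ b‖ ≤ (∑ u, ‖fourierZMod f u‖) * √p := by
  have h1 : ∑ b, f (b ^ 2) * ψ b - fourierZMod f 0 * ∑ b, ψ b
      = ∑ u, fourierZMod f u * (∑ b, ZMod.stdAddChar (u * b ^ 2) * ψ b
          - if u = 0 then ∑ b, ψ b else 0) := by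
    simp_rw [mul_sub, mul_ite, mul_zero, sum_sub_distrib, sum_ite_eq' univ (0 : ZMod p), mem_univ,
      if_true, mul_sum]
    rw [sum_comm]
    congr 1
    refine sum_congr rfl fun b _ => ?_
    rw [← sum_fourierZMod_mul_stdAddChar f (b ^ 2), sum_mul]
    refine sum_congr rfl fun u _ => by ring
  rw [h1, sum_mul]
  refine (norm_sum_le _ _).trans (sum_le_sum fun u _ => ?_)
  rw [norm_mul]
  refine mul_le_mul_of_nonneg_left ?_ (norm_nonneg _)
  split_ifs with hu
  · simp [hu]
  · rw [sub_zero]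
    exact norm_sum_stdAddChar_mul_sq_le hp hu ψ

theorem norm_sum_stdAddChar_binary_le (hp : p ≠ 2) {A B C : ZMod p}
    (h : ¬ (A = 0 ∧ B = 0 ∧ C = 0)) :
    ‖∑ b : ZMod p, ∑ e : ZMod p, (ZMod.stdAddChar (A * b ^ 2 + B * (b * e) + C * e ^ 2) : ℂ)‖
      ≤ p * √p := by
  have hnn : ∀ C' : ZMod p, C' ≠ 0 → ∀ A' : ZMod p,
      ‖∑ b : ZMod p, ∑ e : ZMod p, (ZMod.stdAddChar (A' * b ^ 2 + B * (b * e) + C' * e ^ 2) : ℂ)‖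
        ≤ p * √p := by
    intro C' hC A'
    have : ∀ b : ZMod p, ‖∑ e : ZMod p,
        (ZMod.stdAddChar (A' * b ^ 2 + B * (b * e) + C' * e ^ 2) : ℂ)‖ ≤ √p := by
      intro b
      have e1 : ∑ e : ZMod p, (ZMod.stdAddChar (A' * b ^ 2 + B * (b * e) + C' * e ^ 2) : ℂ)
          = ZMod.stdAddChar (A' * b ^ 2) * ∑ e : ZMod p, ZMod.stdAddChar (C' * e ^ 2) *
            (AddChar.mulShift ZMod.stdAddChar (B * b) : AddChar (ZMod p) ℂ) e := by
        rw [mul_sum]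
        refine sum_congr rfl fun e _ => ?_
        rw [AddChar.mulShift_apply, AddChar.map_add_eq_mul, AddChar.map_add_eq_mul, mul_assoc B]
        ring
      rw [e1, norm_mul, AddChar.norm_apply, one_mul]
      exact norm_sum_stdAddChar_mul_sq_le hp hC _
    refine (norm_sum_le _ _).trans ((sum_le_sum fun b _ => this b).trans ?_)
    simp [ZMod.card]
  by_cases hC : C = 0
  · by_cases hA : A = 0
    · have hB : B ≠ 0 := fun hB => h ⟨hA, hB, hC⟩
      have e1 : ∀ b : ZMod p, ∑ e : ZMod p,
          (ZMod.stdAddChar (A * b ^ 2 + B * (b * e) + C * e ^ 2) : ℂ)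
            = if b = 0 then (p : ℂ) else 0 := by
        intro b
        have := AddChar.sum_mulShift (B * b) (ZMod.isPrimitive_stdAddChar p)
        simp only [mul_eq_zero, hB, false_or, ZMod.card] at this
        rw [Nat.cast_ite, Nat.cast_zero] at this
        rw [← this]
        refine sum_congr rfl fun e _ => ?_
        rw [hA, hC]
        congr 1
        ring
      simp_rw [e1, sum_ite_eq' univ (0 : ZMod p), mem_univ, if_true]
      rw [Complex.norm_natCast]
      refine le_mul_of_one_le_right (Nat.cast_nonneg _) ?_
      rw [Real.one_le_sqrt]
      exact_mod_cast (Fact.out : p.Prime).one_le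
    · rw [sum_comm]
      refine le_trans (le_of_eq ?_) (hnn A hA C)
      congr 1
      refine sum_congr rfl fun e _ => sum_congr rfl fun b _ => ?_
      congr 1
      ring
  · exact hnn C hC A

theorem sum_mul_sum_mul_sum {ι R : Type*} [Fintype ι] [CommSemiring R] (a b c : ι → R) :
    (∑ u, a u) * (∑ v, b v) * ∑ w, c w = ∑ t : ι × ι × ι, a t.1 * b t.2.1 * c t.2.2 := by
  simp_rw [Fintype.sum_prod_type, ← mul_sum, ← sum_mul]
  rw [sum_mul_sum]

theorem norm_sum_three_squares_sub_le (hp : p ≠ 2) (f : ZMod p → ℂ) :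
    ‖∑ b : ZMod p, ∑ e : ZMod p, f (b ^ 2) * f ((b + e) ^ 2) * f ((b + 2 * e) ^ 2)
      - fourierZMod f 0 ^ 3 * p ^ 2‖ ≤ (∑ u, ‖fourierZMod f u‖) ^ 3 * (p * √p) := by
  set F := fourierZMod f with hF
  have h2 : (2 : ZMod p) ≠ 0 := by exact_mod_cast ZMod.prime_ne_zero p 2 hp
  set T : ZMod p × ZMod p × ZMod p → ℂ := fun t => ∑ b : ZMod p, ∑ e : ZMod p,
    ZMod.stdAddChar (t.1 * b ^ 2) * ZMod.stdAddChar (t.2.1 * (b + e) ^ 2) *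
      ZMod.stdAddChar (t.2.2 * (b + 2 * e) ^ 2) with hT
  have h1 : ∑ b : ZMod p, ∑ e : ZMod p, f (b ^ 2) * f ((b + e) ^ 2) * f ((b + 2 * e) ^ 2)
      - F 0 ^ 3 * p ^ 2 = ∑ t : ZMod p × ZMod p × ZMod p, F t.1 * F t.2.1 * F t.2.2 *
        (T t - if t = 0 then (p : ℂ) ^ 2 else 0) := by
    simp_rw [mul_sub, mul_ite, mul_zero, sum_sub_distrib,
      sum_ite_eq' univ (0 : ZMod p × ZMod p × ZMod p), mem_univ, if_true, hT, mul_sum]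
    congr 1
    · symm
      rw [sum_comm]
      refine sum_congr rfl fun b _ => ?_
      rw [sum_comm]
      refine sum_congr rfl fun e _ => ?_
      rw [← sum_fourierZMod_mul_stdAddChar f (b ^ 2),
        ← sum_fourierZMod_mul_stdAddChar f ((b + e) ^ 2),
        ← sum_fourierZMod_mul_stdAddChar f ((b + 2 * e) ^ 2)]
      rw [sum_mul_sum_mul_sum]
      refine sum_congr rfl fun t _ => ?_
      ring
    · simp only [Prod.fst_zero, Prod.snd_zero]
      ring
  have h3 : (∑ u, ‖F u‖) ^ 3 = ∑ t : ZMod p × ZMod p × ZMod p,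
      ‖F t.1 * F t.2.1 * F t.2.2‖ := by
    simp_rw [norm_mul]
    rw [← sum_mul_sum_mul_sum (fun u => ‖F u‖) (fun u => ‖F u‖) fun u => ‖F u‖]
    ring
  rw [h1, h3, sum_mul]
  refine (norm_sum_le _ _).trans (sum_le_sum fun t _ => ?_)
  rw [norm_mul]
  refine mul_le_mul_of_nonneg_left ?_ (norm_nonneg _)
  obtain ⟨u, v, w⟩ := t
  split_ifs with ht
  · simp only [Prod.mk_eq_zero] at ht
    obtain ⟨rfl, rfl, rfl⟩ := ht
    have : T (0, 0, 0) = (p : ℂ) ^ 2 := by simp [hT, ZMod.card, sq]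
    rw [this, sub_self, norm_zero]
    positivity
  · rw [sub_zero]
    have h4 : T (u, v, w) = ∑ b : ZMod p, ∑ e : ZMod p,
        (ZMod.stdAddChar ((u + v + w) * b ^ 2 + (2 * v + 4 * w) * (b * e)
          + (v + 4 * w) * e ^ 2) : ℂ) := by
      refine sum_congr rfl fun b _ => sum_congr rfl fun e _ => ?_
      rw [← AddChar.map_add_eq_mul, ← AddChar.map_add_eq_mul]
      congr 1
      ring
    rw [h4]
    refine norm_sum_stdAddChar_binary_le hp fun ⟨ha, hb, hc⟩ => ht ?_
    have hv : v = 0 := by linear_combination hb - hc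
    have hw : w = 0 := by
      have : (2 * 2 : ZMod p) * w = 0 := by linear_combination hc - hv
      simpa [h2] using this
    have hu : u = 0 := by linear_combination ha - hv - hw
    simp [hu, hv, hw]

end FourierAnalysis

theorem two_mul_min_le_sin_pi_mul {x : ℝ} (h0 : 0 ≤ x) (h1 : x ≤ 1) :
    2 * min x (1 - x) ≤ Real.sin (Real.pi * x) := by
  have hpi := Real.pi_pos
  rcases le_total x (1 / 2) with h | h
  · have := Real.mul_le_sin (x := Real.pi * x) (by positivity) (by nlinarith)
    rw [min_eq_left (by linarith)]
    calc 2 * x = 2 / Real.pi * (Real.pi * x) := by field_simp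
      _ ≤ _ := this
  · have := Real.mul_le_sin (x := Real.pi * (1 - x)) (mul_nonneg hpi.le (by linarith))
      (by nlinarith)
    rw [min_eq_right (by linarith)]
    calc 2 * (1 - x) = 2 / Real.pi * (Real.pi * (1 - x)) := by field_simp
      _ ≤ _ := this
      _ = _ := by rw [mul_sub, mul_one, Real.sin_pi_sub]

theorem norm_stdAddChar_sub_one {p : ℕ} [NeZero p] (u : ZMod p) :
    ‖(ZMod.stdAddChar u : ℂ) - 1‖ = 2 * Real.sin (Real.pi * ((u.val : ℝ) / p)) := by
  have h1 : (ZMod.stdAddChar u : ℂ)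
      = Complex.exp (Complex.I * ((2 * Real.pi * ((u.val : ℝ) / p) : ℝ) : ℂ)) := by
    conv_lhs => rw [← ZMod.natCast_zmod_val u]
    have := ZMod.stdAddChar_coe (N := p) (u.val : ℤ)
    rw [Int.cast_natCast] at this
    rw [this]
    congr 1
    push_cast
    ring
  have hp : (0 : ℝ) < p := by exact_mod_cast NeZero.pos p
  have h2 : (u.val : ℝ) / p ≤ 1 := by
    rw [div_le_one hp]
    exact_mod_cast (ZMod.val_lt u).le
  have h3 : 0 ≤ (u.val : ℝ) / p := by positivity
  rw [h1, Complex.norm_exp_I_mul_ofReal_sub_one, Real.norm_eq_abs, abs_of_nonneg]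
  · congr 2
    ring
  · refine mul_nonneg zero_le_two (Real.sin_nonneg_of_nonneg_of_le_pi ?_ ?_)
    · have := Real.pi_pos
      positivity
    · nlinarith [Real.pi_pos]

theorem sum_residueInterval {p a h : ℕ} [NeZero p] (hah : a + h ≤ p) {E : Type*}
    [AddCommMonoid E] (g : ZMod p → E) :
    ∑ x ∈ residueInterval p a h, g x = ∑ j ∈ range h, g ((a + j : ℕ) : ZMod p) := by
  have hval : ∀ j < h, ((a + j : ℕ) : ZMod p).val = a + j := fun j hj =>
    ZMod.val_cast_of_lt (by omega)
  symm
  refine sum_bij (fun j _ => ((a + j : ℕ) : ZMod p)) (fun j hj => ?_) (fun i hi j hj hij => ?_)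
    (fun x hx => ?_) (fun _ _ => rfl)
  · rw [mem_range] at hj
    rw [mem_residueInterval, hval j hj]
    omega
  · rw [mem_range] at hi hj
    have := congrArg ZMod.val hij
    rw [hval i hi, hval j hj] at this
    omega
  · rw [mem_residueInterval] at hx
    refine ⟨x.val - a, by rw [mem_range]; omega, ?_⟩
    rw [Nat.add_sub_cancel' hx.1, ZMod.natCast_zmod_val]

theorem fourierZMod_indicatorFn {p : ℕ} [NeZero p] (A : Finset (ZMod p)) (u : ZMod p) :
    fourierZMod (indicatorFn ℂ A) u = (∑ x ∈ A, ZMod.stdAddChar (-(u * x))) / (p : ℂ) := by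
  classical
  simp [fourierZMod, indicatorFn, Set.indicator_apply, ite_mul, sum_ite_mem]

theorem fourierZMod_residueInterval_zero {p a h : ℕ} [NeZero p] (hah : a + h ≤ p) :
    fourierZMod (indicatorFn ℂ (residueInterval p a h)) 0 = (h : ℂ) / p := by
  rw [fourierZMod_indicatorFn, sum_residueInterval hah]
  simp

theorem norm_fourierZMod_residueInterval_le {p a h : ℕ} [NeZero p] (hah : a + h ≤ p)
    {u : ZMod p} (hu : u ≠ 0) :
    ‖fourierZMod (indicatorFn ℂ (residueInterval p a h)) u‖
      ≤ (1 / 2) * ((u.val : ℝ)⁻¹ + ((p : ℝ) - u.val)⁻¹) := by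
  have hp : (0 : ℝ) < p := by exact_mod_cast NeZero.pos p
  have hm : (0 : ℝ) < u.val := by
    exact_mod_cast Nat.pos_of_ne_zero fun h0 => hu ((ZMod.val_eq_zero u).1 h0)
  have hm' : (0 : ℝ) < p - u.val := by
    rw [sub_pos]
    exact_mod_cast ZMod.val_lt u
  set z : ℂ := ZMod.stdAddChar (-u) with hz
  have hzn : ‖z‖ = 1 := AddChar.norm_apply _ _
  have hz1 : ‖z - 1‖ = ‖(ZMod.stdAddChar u : ℂ) - 1‖ := by
    rw [hz, AddChar.map_neg_eq_conj, ← Complex.norm_conj, map_sub, Complex.conj_conj, map_one]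
  have h1 : ∑ x ∈ residueInterval p a h, (ZMod.stdAddChar (-(u * x)) : ℂ)
      = ZMod.stdAddChar (-(u * (a : ZMod p))) * ∑ j ∈ range h, z ^ j := by
    rw [sum_residueInterval hah, mul_sum]
    refine sum_congr rfl fun j _ => ?_
    rw [hz, ← AddChar.map_nsmul_eq_pow, ← AddChar.map_add_eq_mul]
    congr 1
    rw [nsmul_eq_mul]
    push_cast
    ring
  have h2 : ‖∑ j ∈ range h, z ^ j‖ * ‖z - 1‖ ≤ 2 := by
    rw [← norm_mul, geom_sum_mul]
    refine (norm_sub_le _ _).trans ?_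
    rw [norm_pow, hzn, one_pow, norm_one]
    norm_num
  have hsin := two_mul_min_le_sin_pi_mul (x := (u.val : ℝ) / p) (by positivity)
    (by rw [div_le_one hp]; linarith)
  rw [hz1, norm_stdAddChar_sub_one] at h2
  rw [fourierZMod_indicatorFn, h1, norm_div, norm_mul, AddChar.norm_apply, one_mul,
    Complex.norm_natCast, div_le_iff₀ hp]
  have hmin : min ((u.val : ℝ) / p) (1 - (u.val : ℝ) / p)
      = min (u.val : ℝ) (p - u.val) / p := by
    rw [← min_div_div_right hp.le, sub_div, div_self hp.ne']
  rw [hmin] at hsin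
  set G := ‖∑ j ∈ range h, z ^ j‖ with hG
  have hG0 : 0 ≤ G := norm_nonneg _
  set m := min (u.val : ℝ) (p - u.val) with hmdef
  have hm0 : 0 < m := lt_min hm hm'
  have h3 : G * (2 * (2 * (m / p))) ≤ 2 :=
    (mul_le_mul_of_nonneg_left (mul_le_mul_of_nonneg_left hsin zero_le_two) hG0).trans h2
  have h4 : G ≤ 1 / 2 * m⁻¹ * p := by
    have : G * (2 * (2 * (m / p))) * (m⁻¹ * p) = 4 * G := by field_simp; norm_num
    nlinarith [mul_le_mul_of_nonneg_right h3 (show 0 ≤ m⁻¹ * p by positivity)]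
  refine h4.trans ?_
  gcongr
  have i1 := inv_pos.2 hm
  have i2 := inv_pos.2 hm'
  rcases min_choice (u.val : ℝ) (p - u.val) with hc | hc <;> rw [hmdef, hc] <;> linarith

theorem sum_norm_fourierZMod_residueInterval_le {p a h : ℕ} [NeZero p] (hah : a + h ≤ p) :
    ∑ u, ‖fourierZMod (indicatorFn ℂ (residueInterval p a h)) u‖ ≤ 2 + Real.log p := by
  have hp : (0 : ℝ) < p := by exact_mod_cast NeZero.pos p
  have hterm : ∀ u : ZMod p, ‖fourierZMod (indicatorFn ℂ (residueInterval p a h)) u‖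
      ≤ (if u = 0 then 1 else 0) + (1 / 2) * ((u.val : ℝ)⁻¹ + ((p : ℝ) - u.val)⁻¹) := by
    intro u
    split_ifs with hu
    · rw [hu, fourierZMod_residueInterval_zero hah, norm_div, Complex.norm_natCast,
        Complex.norm_natCast, ZMod.val_zero]
      have h1 : (h : ℝ) / p ≤ 1 := by
        rw [div_le_one hp]
        exact_mod_cast (Nat.le_add_left h a).trans hah
      have h2 : (0 : ℝ) ≤ (1 / 2) * (((0 : ℕ) : ℝ)⁻¹ + ((p : ℝ) - (0 : ℕ))⁻¹) := by
        simp only [Nat.cast_zero, inv_zero, zero_add, sub_zero]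
        positivity
      linarith
    · rw [zero_add]
      exact norm_fourierZMod_residueInterval_le hah hu
  have hH : ((harmonic p : ℚ) : ℝ) = ∑ i ∈ range p, ((i : ℝ) + 1)⁻¹ := by
    simp [harmonic]
  have hval : ∀ g : ℕ → ℝ, ∑ u : ZMod p, g u.val = ∑ m ∈ range p, g m := by
    intro g
    have h0 : residueInterval p 0 p = univ := by
      ext x
      simp [mem_residueInterval, ZMod.val_lt x]
    rw [← h0, sum_residueInterval (by omega)]
    refine sum_congr rfl fun m hm => ?_
    rw [zero_add, ZMod.val_cast_of_lt (mem_range.1 hm)]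
  have hA : ∑ m ∈ range p, (m : ℝ)⁻¹ ≤ harmonic p := by
    rw [hH]
    have h1 := sum_range_succ' (fun m : ℕ => (m : ℝ)⁻¹) p
    have h2 := sum_range_succ (fun m : ℕ => (m : ℝ)⁻¹) p
    simp only [Nat.cast_zero, inv_zero, add_zero, Nat.cast_add, Nat.cast_one] at h1
    have : (0 : ℝ) < (p : ℝ)⁻¹ := inv_pos.2 hp
    linarith
  have hB : ∑ m ∈ range p, ((p : ℝ) - m)⁻¹ = harmonic p := by
    rw [hH, ← sum_range_reflect]
    refine sum_congr rfl fun m hm => ?_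
    rw [mem_range] at hm
    rw [Nat.sub_sub, Nat.cast_sub (by omega)]
    push_cast
    congr 1
    ring
  calc ∑ u, ‖fourierZMod (indicatorFn ℂ (residueInterval p a h)) u‖
      ≤ ∑ u : ZMod p, ((if u = 0 then 1 else 0)
          + (1 / 2) * ((u.val : ℝ)⁻¹ + ((p : ℝ) - u.val)⁻¹)) := sum_le_sum fun u _ => hterm u
    _ = 1 + (1 / 2) * (∑ m ∈ range p, (m : ℝ)⁻¹ + ∑ m ∈ range p, ((p : ℝ) - m)⁻¹) := by
        rw [sum_add_distrib, ← mul_sum, sum_ite_eq' univ (0 : ZMod p), if_pos (mem_univ _),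
          hval fun m => (m : ℝ)⁻¹ + ((p : ℝ) - m)⁻¹, sum_add_distrib]
    _ ≤ 2 + Real.log p := by
        rw [hB]
        linarith [harmonic_le_one_add_log p]

section QuadraticColorSet

variable {Q p : ℕ} [NeZero Q] [Fact p.Prime]

/-- The set of `n` mod `Qp` whose square mod `p` lies in a set prescribed by `n` mod `Q`. -/
def quadraticColorSet (hQp : Q.Coprime p) (S : ZMod Q → Finset (ZMod p)) :
    Finset (ZMod (Q * p)) :=
  univ.filter fun n => (ZMod.chineseRemainder hQp n).2 ^ 2 ∈ S (ZMod.chineseRemainder hQp n).1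

theorem indicatorFn_quadraticColorSet (𝕜 : Type*) [Zero 𝕜] [One 𝕜] (hQp : Q.Coprime p)
    (S : ZMod Q → Finset (ZMod p)) (n : ZMod (Q * p)) :
    indicatorFn 𝕜 (quadraticColorSet hQp S) n
      = indicatorFn 𝕜 (S (ZMod.chineseRemainder hQp n).1) ((ZMod.chineseRemainder hQp n).2 ^ 2) := by
  classical
  simp [indicatorFn, quadraticColorSet, Set.indicator_apply]

theorem norm_sum_quadraticColorSet_sub_le (hp : p ≠ 2) (hQp : Q.Coprime p)
    {S : ZMod Q → Finset (ZMod p)} {β : ℂ} {L : ℝ}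
    (hβ : ∀ a, fourierZMod (indicatorFn ℂ (S a)) 0 = β)
    (hL : ∀ a, ∑ u, ‖fourierZMod (indicatorFn ℂ (S a)) u‖ ≤ L) (ψ : AddChar (ZMod (Q * p)) ℂ) :
    ‖∑ n, indicatorFn ℂ (quadraticColorSet hQp S) n * ψ n - β * ∑ n, ψ n‖ ≤ Q * (L * √p) := by
  set E := ZMod.chineseRemainder hQp with hE
  set ψ₂ : AddChar (ZMod p) ℂ := ψ.compAddMonoidHom
    ((E.symm : ZMod Q × ZMod p →+ ZMod (Q * p)).comp (AddMonoidHom.inr (ZMod Q) (ZMod p))) with hψ₂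
  have hψ : ∀ a b, ψ (E.symm (a, b)) = ψ (E.symm (a, 0)) * ψ₂ b := by
    intro a b
    have : ψ₂ b = ψ (E.symm (0, b)) := rfl
    rw [this, ← AddChar.map_add_eq_mul, ← map_add]
    simp
  have h1 : ∑ n, indicatorFn ℂ (quadraticColorSet hQp S) n * ψ n - β * ∑ n, ψ n
      = ∑ a : ZMod Q, ψ (E.symm (a, 0)) * (∑ b, indicatorFn ℂ (S a) (b ^ 2) * ψ₂ b
          - fourierZMod (indicatorFn ℂ (S a)) 0 * ∑ b, ψ₂ b) := by
    rw [← Equiv.sum_comp E.symm.toEquiv, ← Equiv.sum_comp E.symm.toEquiv (fun n => ψ n),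
      Fintype.sum_prod_type, Fintype.sum_prod_type, mul_sum, ← sum_sub_distrib]
    refine sum_congr rfl fun a _ => ?_
    rw [hβ, mul_sub, mul_sum, mul_sum, mul_sum, mul_sum]
    congr 1 <;> refine sum_congr rfl fun b _ => ?_
    · rw [indicatorFn_quadraticColorSet, ← hE, RingEquiv.toEquiv_eq_coe, EquivLike.coe_coe,
        RingEquiv.apply_symm_apply, hψ]
      ring
    · rw [RingEquiv.toEquiv_eq_coe, EquivLike.coe_coe, hψ]
      ring
  rw [h1]
  calc _ ≤ ∑ a : ZMod Q, L * √p := by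
        refine (norm_sum_le _ _).trans (sum_le_sum fun a _ => ?_)
        rw [norm_mul, AddChar.norm_apply, one_mul]
        exact (norm_sum_comp_sq_mul_addChar_sub_le hp _ _).trans
          (mul_le_mul_of_nonneg_right (hL a) (Real.sqrt_nonneg _))
    _ = Q * (L * √p) := by simp [ZMod.card]

theorem isFourierUniform_quadraticColorSet (hp : p ≠ 2) (hQp : Q.Coprime p)
    {S : ZMod Q → Finset (ZMod p)} {β : ℂ} {L : ℝ}
    (hβ : ∀ a, fourierZMod (indicatorFn ℂ (S a)) 0 = β)
    (hL : ∀ a, ∑ u, ‖fourierZMod (indicatorFn ℂ (S a)) u‖ ≤ L) :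
    IsFourierUniform (L / √p) (quadraticColorSet hQp S) := by
  intro s hs
  have hQ0 : (0 : ℝ) < Q := by exact_mod_cast NeZero.pos Q
  have hp0 : (0 : ℝ) < p := by exact_mod_cast NeZero.pos p
  have h1 := norm_sum_quadraticColorSet_sub_le hp hQp hβ hL
    (AddChar.mulShift ZMod.stdAddChar (-s))
  have h2 : ∑ n, (AddChar.mulShift (ZMod.stdAddChar (N := Q * p)) (-s)) n = 0 := by
    have := AddChar.sum_mulShift (-s) (ZMod.isPrimitive_stdAddChar (Q * p))
    rw [if_neg (neg_ne_zero.2 hs), Nat.cast_zero] at this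
    rw [← this]
    refine sum_congr rfl fun n _ => ?_
    rw [AddChar.mulShift_apply, mul_comm n]
  rw [h2, mul_zero, sub_zero] at h1
  simp_rw [AddChar.mulShift_apply, neg_mul] at h1
  rw [fourierZMod, norm_div, Complex.norm_natCast, Nat.cast_mul, div_le_div_iff₀ (by positivity)
    (by positivity)]
  calc _ ≤ Q * (L * √p) * √p := mul_le_mul_of_nonneg_right h1 (Real.sqrt_nonneg _)
    _ = L * (Q * p) := by
      rw [mul_assoc, mul_assoc, Real.mul_self_sqrt hp0.le]
      ring

theorem card_quadraticColorSet_ge (hp : p ≠ 2) (hQp : Q.Coprime p)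
    {S : ZMod Q → Finset (ZMod p)} {β L : ℝ}
    (hβ : ∀ a, fourierZMod (indicatorFn ℂ (S a)) 0 = β)
    (hL : ∀ a, ∑ u, ‖fourierZMod (indicatorFn ℂ (S a)) u‖ ≤ L) :
    (β - L / √p) * (Q * p : ℕ) ≤ #(quadraticColorSet hQp S) := by
  have hp0 : (0 : ℝ) < p := by exact_mod_cast NeZero.pos p
  have h1 := norm_sum_quadraticColorSet_sub_le hp hQp hβ hL 1
  have h2 : ∑ n, indicatorFn ℂ (quadraticColorSet hQp S) n * (1 : AddChar (ZMod (Q * p)) ℂ) n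
      = (#(quadraticColorSet hQp S) : ℂ) := by
    classical
    simp [indicatorFn, Set.indicator_apply, sum_ite_mem]
  have h3 : ∑ n, (1 : AddChar (ZMod (Q * p)) ℂ) n = ((Q * p : ℕ) : ℂ) := by
    simp [ZMod.card]
  rw [h2, h3] at h1
  have h4 : ‖((#(quadraticColorSet hQp S) - β * (Q * p : ℕ) : ℝ) : ℂ)‖ ≤ Q * (L * √p) := by
    simpa using h1
  rw [Complex.norm_real, Real.norm_eq_abs, abs_le] at h4
  have h5 : L / √p * (Q * p : ℕ) = Q * (L * √p) := by
    have : (p : ℝ) / √p = √p := Real.div_sqrt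
    calc L / √p * (Q * p : ℕ) = Q * (L * (p / √p)) := by push_cast; ring
      _ = _ := by rw [this]
  rw [sub_mul, h5]
  linarith [h4.1]

theorem sum_three_squares_indicatorFn_le (hp : p ≠ 2) {T : Finset (ZMod p)} {β L : ℝ}
    (hβ : fourierZMod (indicatorFn ℂ T) 0 = β)
    (hL : ∑ u, ‖fourierZMod (indicatorFn ℂ T) u‖ ≤ L) :
    ∑ b : ZMod p, ∑ e : ZMod p, indicatorFn ℝ T (b ^ 2) * indicatorFn ℝ T ((b + e) ^ 2) *
      indicatorFn ℝ T ((b + 2 * e) ^ 2) ≤ β ^ 3 * p ^ 2 + L ^ 3 * (p * √p) := by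
  have h1 := norm_sum_three_squares_sub_le hp (indicatorFn ℂ T)
  have h2 : ∀ x, indicatorFn ℂ T x = (indicatorFn ℝ T x : ℂ) := by
    classical
    intro x
    simp only [indicatorFn, Set.indicator_apply]
    split_ifs <;> simp
  rw [hβ] at h1
  simp_rw [h2] at h1
  have h3 := (Complex.abs_re_le_norm _).trans h1
  have h4 : (∑ u, ‖fourierZMod (indicatorFn ℂ T) u‖) ^ 3 * (p * √p) ≤ L ^ 3 * (p * √p) := by
    gcongr
  have h5 := (le_abs_self _).trans (h3.trans h4)
  rw [Complex.sub_re] at h5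
  norm_cast at h5
  rw [Nat.cast_pow] at h5
  linarith

theorem Lambda4_quadraticColorSet_le (hp : p ≠ 2) (hQp : Q.Coprime p)
    {S : ZMod Q → Finset (ZMod p)} {β L : ℝ}
    (hβ : ∀ a, fourierZMod (indicatorFn ℂ (S a)) 0 = β)
    (hL : ∀ a, ∑ u, ‖fourierZMod (indicatorFn ℂ (S a)) u‖ ≤ L)
    (hS : ∀ a d : ZMod Q, d ≠ 0 → ∀ x₀ ∈ S a, ∀ x₁ ∈ S (a + d), ∀ x₂ ∈ S (a + 2 * d),
      ∀ x₃ ∈ S (a + 3 * d), x₀ - 3 * x₁ + 3 * x₂ - x₃ ≠ 0) :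
    Lambda4 (indicatorFn ℝ (quadraticColorSet hQp S)) ≤ (β ^ 3 + L ^ 3 / √p) / Q := by
  classical
  have hQ0 : (0 : ℝ) < Q := by exact_mod_cast NeZero.pos Q
  have hp0 : (0 : ℝ) < p := by exact_mod_cast NeZero.pos p
  set E := ZMod.chineseRemainder hQp with hE
  set g : ZMod Q → ZMod p → ℝ := fun a => indicatorFn ℝ (S a) with hg
  have hg01 : ∀ a x, 0 ≤ g a x ∧ g a x ≤ 1 := by
    intro a x
    simp only [hg, indicatorFn, Set.indicator_apply]
    split_ifs <;> norm_num
  have hmem : ∀ a x, g a x ≠ 0 → x ∈ S a := by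
    intro a x hx
    simpa [hg, indicatorFn, Set.indicator_apply] using hx
  have key : ∀ (a d : ZMod Q) (b e : ZMod p),
      g a (b ^ 2) * g (a + d) ((b + e) ^ 2) * g (a + 2 * d) ((b + 2 * e) ^ 2) *
        g (a + 3 * d) ((b + 3 * e) ^ 2)
      ≤ if d = 0 then g a (b ^ 2) * g a ((b + e) ^ 2) * g a ((b + 2 * e) ^ 2) else 0 := by
    intro a d b e
    split_ifs with hd
    · subst hd
      simp only [mul_zero, add_zero]
      exact mul_le_of_le_one_right (mul_nonneg (mul_nonneg (hg01 _ _).1 (hg01 _ _).1) (hg01 _ _).1)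
        (hg01 _ _).2
    · refine le_of_eq ?_
      by_contra hne
      simp only [mul_ne_zero_iff] at hne
      obtain ⟨⟨⟨h0, h1⟩, h2⟩, h3⟩ := hne
      exact hS a d hd _ (hmem _ _ h0) _ (hmem _ _ h1) _ (hmem _ _ h2) _ (hmem _ _ h3) (by ring)
  have hsum : ∑ n : ZMod (Q * p), ∑ d : ZMod (Q * p),
      indicatorFn ℝ (quadraticColorSet hQp S) n * indicatorFn ℝ (quadraticColorSet hQp S) (n + d) *
      indicatorFn ℝ (quadraticColorSet hQp S) (n + 2 * d) *
      indicatorFn ℝ (quadraticColorSet hQp S) (n + 3 * d)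
      ≤ Q * (β ^ 3 * p ^ 2 + L ^ 3 * (p * √p)) := by
    calc _ = ∑ n : ZMod (Q * p), ∑ d : ZMod (Q * p), g (E n).1 ((E n).2 ^ 2) *
          g ((E n).1 + (E d).1) (((E n).2 + (E d).2) ^ 2) *
          g ((E n).1 + 2 * (E d).1) (((E n).2 + 2 * (E d).2) ^ 2) *
          g ((E n).1 + 3 * (E d).1) (((E n).2 + 3 * (E d).2) ^ 2) := by
          refine sum_congr rfl fun n _ => sum_congr rfl fun d _ => ?_
          simp only [indicatorFn_quadraticColorSet, ← hE, map_add, map_mul, map_ofNat,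
            Prod.fst_add, Prod.snd_add, Prod.fst_mul, Prod.snd_mul, Prod.fst_ofNat,
            Prod.snd_ofNat, hg]
      _ = ∑ x : ZMod Q × ZMod p, ∑ y : ZMod Q × ZMod p, g x.1 (x.2 ^ 2) *
          g (x.1 + y.1) ((x.2 + y.2) ^ 2) * g (x.1 + 2 * y.1) ((x.2 + 2 * y.2) ^ 2) *
          g (x.1 + 3 * y.1) ((x.2 + 3 * y.2) ^ 2) := by
          rw [← Equiv.sum_comp E.toEquiv]
          refine sum_congr rfl fun n _ => ?_
          rw [← Equiv.sum_comp E.toEquiv]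
          rfl
      _ ≤ ∑ x : ZMod Q × ZMod p, ∑ y : ZMod Q × ZMod p, if y.1 = 0 then
          g x.1 (x.2 ^ 2) * g x.1 ((x.2 + y.2) ^ 2) * g x.1 ((x.2 + 2 * y.2) ^ 2) else 0 :=
          sum_le_sum fun x _ => sum_le_sum fun y _ => key _ _ _ _
      _ = ∑ a : ZMod Q, ∑ b : ZMod p, ∑ e : ZMod p,
          g a (b ^ 2) * g a ((b + e) ^ 2) * g a ((b + 2 * e) ^ 2) := by
          rw [Fintype.sum_prod_type]
          refine sum_congr rfl fun a _ => sum_congr rfl fun b _ => ?_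
          rw [Fintype.sum_prod_type, sum_comm]
          refine sum_congr rfl fun e _ => ?_
          simp
      _ ≤ ∑ a : ZMod Q, (β ^ 3 * p ^ 2 + L ^ 3 * (p * √p)) :=
          sum_le_sum fun a _ => sum_three_squares_indicatorFn_le hp (hβ a) (hL a)
      _ = _ := by rw [sum_const, card_univ, ZMod.card, nsmul_eq_mul]
  rw [Lambda4]
  refine (div_le_div_of_nonneg_right hsum (by positivity)).trans (le_of_eq ?_)
  have h6 : (p : ℝ) * √p = p ^ 2 * (1 / √p) := by
    rw [mul_one_div, eq_div_iff (Real.sqrt_pos.2 hp0).ne', mul_assoc, Real.mul_self_sqrt hp0.le, sq]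
  rw [h6]
  push_cast
  field_simp

end QuadraticColorSet

open Filter Topology in
theorem tendsto_two_add_log_pow_three_div_sqrt :
    Tendsto (fun x : ℝ => (2 + Real.log x) ^ 3 / √x) atTop (𝓝 0) := by
  have h1 : (fun x : ℝ => 2 + Real.log x) =o[atTop] fun x : ℝ => x ^ (1 / 6 : ℝ) := by
    refine Asymptotics.IsLittleO.add ?_ (isLittleO_log_rpow_atTop (by norm_num))
    refine Asymptotics.isLittleO_const_left.2 (Or.inr ?_)
    exact tendsto_norm_atTop_atTop.comp (tendsto_rpow_atTop (by norm_num))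
  have h2 := (h1.pow (n := 3) (by norm_num)).tendsto_div_nhds_zero
  refine h2.congr' ?_
  filter_upwards [eventually_ge_atTop 0] with x hx
  rw [← Real.rpow_natCast (x ^ (1 / 6 : ℝ)), ← Real.rpow_mul hx, Real.sqrt_eq_rpow]
  norm_num

open Filter Topology in
theorem exists_prime_log_pow_three_div_sqrt_lt {ε : ℝ} (hε : 0 < ε) (n : ℕ) :
    ∃ p : ℕ, p.Prime ∧ n ≤ p ∧ (2 + Real.log p) ^ 3 / √p < ε ∧ 1 / (p : ℝ) < ε := by
  have h1 := (tendsto_two_add_log_pow_three_div_sqrt.comp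
    (tendsto_natCast_atTop_atTop (R := ℝ))).eventually_lt_const hε
  have h2 := (tendsto_one_div_atTop_nhds_zero_nat (𝕜 := ℝ)).eventually_lt_const hε
  obtain ⟨m, hm⟩ := eventually_atTop.1 (h1.and h2)
  obtain ⟨p, hp, hpp⟩ := Nat.exists_infinite_primes (max m n)
  exact ⟨p, hpp, (le_max_right _ _).trans hp, hm p ((le_max_left _ _).trans hp)⟩

/-- A coloring without symmetrically colored 4-APs bounds the 4-AP density of uniform sets. -/
theorem IsFourAPLowerBound.le_of_coloring {α ρ : ℝ} (hρ : IsFourAPLowerBound α ρ) {Q K : ℕ}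
    [NeZero Q] (hK : 0 < K) {c : ZMod Q → Fin K} (hc : AvoidsSymmetricFourAP c)
    (hα : α ≤ 1 / (16 * K ^ 2)) : ρ ≤ (1 / (16 * K ^ 2)) ^ 3 / Q := by
  have hQ0 : (1 : ℝ) ≤ Q := by exact_mod_cast NeZero.pos Q
  have hK0 : (0 : ℝ) < K := by exact_mod_cast hK
  set δ : ℝ := 1 / (16 * K ^ 2) with hδ
  refine le_of_forall_pos_le_add fun ε hε => ?_
  obtain ⟨η, hη, N₀, H⟩ := hρ (ε / 2) (half_pos hε)
  obtain ⟨p, hpp, hpn, hp1, hp2⟩ := exists_prime_log_pow_three_div_sqrt_lt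
    (lt_min hη (show 0 < ε / 4 by linarith)) (N₀ + Q + 3)
  have : Fact p.Prime := ⟨hpp⟩
  have hp0 : (0 : ℝ) < p := by exact_mod_cast hpp.pos
  have hp2' : p ≠ 2 := by omega
  have hQp : Q.Coprime p :=
    (Nat.coprime_of_lt_prime (NeZero.ne Q) (by omega) hpp).symm
  obtain ⟨f, hf, hf'⟩ := exists_quadratic_growth_unique_add_three_mul
  set h := p / (16 * K ^ 2) with hh
  have hhp : 16 * K ^ 2 * h ≤ p := Nat.mul_div_le _ _
  set S : ZMod Q → Finset (ZMod p) := fun a => residueInterval p (4 * f (c a) * h) h with hSdef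
  have hfit : ∀ a, 4 * f (c a) * h + h ≤ p := by
    intro a
    refine le_trans ?_ hhp
    have h1 := hf (c a)
    have h2 : (c a : ℕ) < K := (c a).2
    have h3 : 4 * f (c a) + 1 ≤ 16 * K ^ 2 := by nlinarith
    calc 4 * f (c a) * h + h = (4 * f (c a) + 1) * h := by ring
      _ ≤ _ := Nat.mul_le_mul_right h h3
  have hβ : ∀ a, fourierZMod (indicatorFn ℂ (S a)) 0 = (((h : ℝ) / p : ℝ) : ℂ) := by
    intro a
    rw [fourierZMod_residueInterval_zero (hfit a)]
    push_cast
    rfl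
  have hL : ∀ a, ∑ u, ‖fourierZMod (indicatorFn ℂ (S a)) u‖ ≤ 2 + Real.log p := fun a =>
    sum_norm_fourierZMod_residueInterval_le (hfit a)
  have hL1 : 1 ≤ 2 + Real.log p := by
    have : 0 ≤ Real.log p := Real.log_natCast_nonneg p
    linarith
  have hL3 : (2 + Real.log p) / √p ≤ (2 + Real.log p) ^ 3 / √p :=
    div_le_div_of_nonneg_right (le_self_pow₀ hL1 (by norm_num)) (Real.sqrt_nonneg _)
  rw [lt_min_iff] at hp1 hp2
  have hβle : (h : ℝ) / p ≤ δ := by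
    rw [hδ, div_le_div_iff₀ hp0 (by positivity), one_mul, mul_comm]
    exact_mod_cast hhp
  have hβge : δ - 1 / p ≤ (h : ℝ) / p := by
    have h1 : p < 16 * K ^ 2 * (h + 1) := Nat.lt_mul_div_succ p (by positivity)
    have h2 : (p : ℝ) ≤ 16 * K ^ 2 * (h + 1) := by exact_mod_cast h1.le
    rw [sub_le_iff_le_add, ← add_div, hδ, div_le_div_iff₀ (by positivity) hp0]
    linarith
  have hu : IsFourierUniform η (quadraticColorSet hQp S) := fun s hs =>
    (isFourierUniform_quadraticColorSet hp2' hQp hβ hL s hs).trans (hL3.trans hp1.1.le)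
  have hcard : (α - ε / 2) * ((Q * p : ℕ) : ℝ) ≤ #(quadraticColorSet hQp S) := by
    refine le_trans (mul_le_mul_of_nonneg_right ?_ (Nat.cast_nonneg _))
      (card_quadraticColorSet_ge hp2' hQp hβ hL)
    linarith [hp1.2, hp2.2]
  have hΛ := H (Q * p) (by nlinarith [NeZero.pos Q]) (quadraticColorSet hQp S) hu hcard
  have hΛ' := Lambda4_quadraticColorSet_le hp2' hQp hβ hL (by
    intro a d hd x₀ m₀ x₁ m₁ x₂ m₂ x₃ m₃ hx
    have := eq_of_mem_residueInterval hhp hf hf' (c a).2 (c (a + d)).2 (c (a + 2 * d)).2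
      (c (a + 3 * d)).2 m₀ m₁ m₂ m₃ hx
    exact hc a d hd ⟨Fin.ext this.1, Fin.ext this.2⟩)
  have h7 : (((h : ℝ) / p) ^ 3 + (2 + Real.log p) ^ 3 / √p) / Q ≤ δ ^ 3 / Q + ε / 4 := by
    rw [add_div]
    refine add_le_add (by gcongr) ((div_le_self ?_ hQ0).trans hp1.2.le)
    positivity
  linarith

theorem mainTheorem2 (r N : ℕ) (hr : 2 ≤ r) (hN : 1 ≤ N)
    (hcol : ∃ c : ZMod N → Fin r, AvoidsSymmetricFourAP c) :
    ∃ C : ℝ, ∀ α : ℝ, 0 < α → α < 1 / 2 →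
      rho4 α ≤ C * α ^ ((3 : ℝ) + (1 / 2 : ℝ) * Real.logb (r : ℝ) (N : ℝ)) := by
  obtain ⟨c, hc⟩ := hcol
  have : NeZero N := ⟨by omega⟩
  have hr1 : (1 : ℝ) < r := by exact_mod_cast hr
  have hr0 : (0 : ℝ) < r := by linarith
  have hN0 : (0 : ℝ) < N := by exact_mod_cast hN
  set θ : ℝ := 1 / 2 * Real.logb r N with hθ
  have hθ0 : 0 ≤ θ := mul_nonneg (by norm_num) (Real.logb_nonneg hr1 (by exact_mod_cast hN))
  have hθN : ((r : ℝ) ^ 2) ^ θ = N := by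
    rw [← Real.rpow_natCast, ← Real.rpow_mul hr0.le, hθ, Nat.cast_ofNat, ← mul_assoc,
      mul_one_div_cancel two_ne_zero, one_mul, Real.rpow_logb hr0 hr1.ne' hN0]
  refine ⟨(16 * r ^ 2) ^ (3 + θ), fun α hα0 hα1 => ?_⟩
  rw [← Real.mul_rpow (by positivity) hα0.le]
  refine csSup_le (rho4_set_nonempty_bddAbove (by linarith)).1 fun ρ hρ => ?_
  rcases lt_or_ge (1 / 16) α with hα | hα
  · refine (isFourAPLowerBound_le_one (by linarith) hρ).trans
      (Real.one_le_rpow ?_ (by linarith))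
    nlinarith
  · obtain ⟨k, hk1, hk2⟩ := exists_nat_pow_near (x := 1 / (16 * α)) (y := (r : ℝ) ^ 2)
      (by rw [le_div_iff₀ (by positivity)]; linarith) (by nlinarith)
    obtain ⟨c', hc'⟩ := hc.pow k
    have hR : (0 : ℝ) < ((r : ℝ) ^ 2) ^ k := by positivity
    have hRk : ((r ^ k : ℕ) : ℝ) ^ 2 = ((r : ℝ) ^ 2) ^ k := by
      push_cast
      rw [← pow_mul, ← pow_mul, mul_comm]
    have h1 := IsFourAPLowerBound.le_of_coloring hρ (by positivity) hc' (by
      rw [hRk, le_div_iff₀ (by positivity)]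
      rw [le_div_iff₀ (by positivity)] at hk1
      linarith)
    refine h1.trans ?_
    rw [hRk]
    set x : ℝ := 1 / ((r : ℝ) ^ 2) ^ k with hx
    have hx0 : 0 < x := by positivity
    have hNk : ((N ^ k : ℕ) : ℝ) = (x ^ θ)⁻¹ := by
      rw [hx, Real.div_rpow zero_le_one hR.le, Real.one_rpow, one_div, inv_inv,
        ← Real.rpow_natCast ((r : ℝ) ^ 2), ← Real.rpow_mul (by positivity), mul_comm,
        Real.rpow_mul (by positivity), hθN]
      push_cast
      rw [Real.rpow_natCast]
    have hxα : x ≤ 16 * r ^ 2 * α := by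
      rw [hx, div_le_iff₀ hR]
      rw [div_lt_iff₀ (by positivity), pow_succ] at hk2
      linarith
    calc (1 / (16 * ((r : ℝ) ^ 2) ^ k)) ^ 3 / ((N ^ k : ℕ) : ℝ)
        ≤ x ^ 3 / ((N ^ k : ℕ) : ℝ) := by
          rw [hx]
          gcongr
          linarith
      _ = x ^ (3 + θ) := by
          rw [hNk, div_inv_eq_mul, Real.rpow_add hx0]
          norm_cast
      _ ≤ (16 * r ^ 2 * α) ^ (3 + θ) := Real.rpow_le_rpow hx0.le hxα (by linarith)
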